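/- Let $G$ be a totally disconnected, locally compact group and let $\alpha : G\to G$ be a continuous endomorphism. For a compact open subgroup $U$ of $G$ put $$U_+ = \{x\in U \mid \exists\, (x_n)_{n\in\mathbb{N}}\subseteq U \text{ with } x_0 = x \text{ and } \alpha(x_{n+1}) = x_n \text{ for every } n\in\mathbb{N}\},$$ $$U_- = \{x\in U \mid \alpha^n(x)\in U \text{ for every } n\in\mathbb{N}\},\qquad U_{++} = \bigcup_{n\ge 0}\alpha^n(U_+).$$ Call $U$ *minimizing* for $\alpha$ if its displacement index $[\alpha(U):\alpha(U)\cap U]$ (which is finite) is the least among the displacement indices $[\alpha(V):\alpha(V)\cap V]$ of all compact open subgroups $V$ of $G$. Call $U$ *tidy* for $\alpha$ if - (TA) $U = U_+U_-$; - (TB1) $U_{++}$ is closed in $G$; and - (TB2) the sequence of integers $\left([\alpha^{n+1}(U_+):\alpha^n(U_+)]\right)_{n\in\mathbb{N}}$ is constant. Then a compact open subgroup $U$ of $G$ is minimizing for $\alpha$ if and only if it is tidy for $\alpha$. Moreover, there exists a compact open subgroup of $G$ that is tidy for $\alpha$. -/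

import Mathlib

open scoped Pointwise

namespace TidyEnd

variable {G : Type*} [Group G]

/-- `IsRegressive α x s`: the sequence `s` is an `α`-regressive sequence for `x`. -/
def IsRegressive (α : G →* G) (x : G) (s : ℕ → G) : Prop :=
  s 0 = x ∧ ∀ n, α (s (n + 1)) = s n

/-- `U₊`: the elements of `U` having an `α`-regressive sequence contained in `U`. -/
def plus (α : G →* G) (U : Subgroup G) : Subgroup G where
  carrier := {x | x ∈ U ∧ ∃ s : ℕ → G, (∀ n, s n ∈ U) ∧ IsRegressive α x s}
  one_mem' := ⟨U.one_mem, fun _ => 1, fun _ => U.one_mem, rfl, fun _ => map_one α⟩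
  mul_mem' := by
    rintro x y ⟨hx, s, hs, hs0, hs1⟩ ⟨hy, t, ht, ht0, ht1⟩
    refine ⟨U.mul_mem hx hy, fun n => s n * t n, fun n => U.mul_mem (hs n) (ht n), ?_, ?_⟩
    · simp only [hs0, ht0]
    · intro n
      simp only [map_mul, hs1, ht1]
  inv_mem' := by
    rintro x ⟨hx, s, hs, hs0, hs1⟩
    refine ⟨U.inv_mem hx, fun n => (s n)⁻¹, fun n => U.inv_mem (hs n), ?_, ?_⟩
    · simp only [hs0]
    · intro n
      simp only [map_inv, hs1]

/-- `U₋`: the elements of `U` whose forward `α`-orbit stays in `U`. -/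
def minus (α : G →* G) (U : Subgroup G) : Subgroup G where
  carrier := {x | x ∈ U ∧ ∀ n : ℕ, α^[n] x ∈ U}
  one_mem' := ⟨U.one_mem, fun n => by simp only [iterate_map_one, U.one_mem]⟩
  mul_mem' := by
    rintro x y ⟨hx, hx'⟩ ⟨hy, hy'⟩
    refine ⟨U.mul_mem hx hy, fun n => ?_⟩
    rw [iterate_map_mul]
    exact U.mul_mem (hx' n) (hy' n)
  inv_mem' := by
    rintro x ⟨hx, hx'⟩
    refine ⟨U.inv_mem hx, fun n => ?_⟩
    rw [iterate_map_inv]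
    exact U.inv_mem (hx' n)

/-- The image subgroup `αⁿ(H)`. -/
def iterMap (α : G →* G) (n : ℕ) (H : Subgroup G) : Subgroup G :=
  (Subgroup.map α)^[n] H

/-- `U₊₊ = ⋃ₙ αⁿ(U₊)`. -/
def plusPlus (α : G →* G) (U : Subgroup G) : Set G :=
  ⋃ n : ℕ, (iterMap α n (plus α U) : Set G)

/-- The displacement index `[α(U) : α(U) ∩ U]`. For `U` compact and open and `α` continuous it is
finite, so that the value `0` (infinite index) does not occur. -/
noncomputable def displacementIndex (α : G →* G) (U : Subgroup G) : ℕ :=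
  (U.map α ⊓ U).relIndex (U.map α)

/-- The displacement index of `U` is the least one among those of all compact open subgroups. -/
def IsMinimizing [TopologicalSpace G] (α : G →* G) (U : Subgroup G) : Prop :=
  ∀ V : Subgroup G, IsCompact (V : Set G) → IsOpen (V : Set G) →
    displacementIndex α U ≤ displacementIndex α V

/-- Condition TA: `U = U₊U₋`. -/
def IsTidyAbove (α : G →* G) (U : Subgroup G) : Prop :=
  (U : Set G) = (plus α U : Set G) * (minus α U : Set G)

/-- Conditions TB1 and TB2: `U₊₊` is closed and the sequence of indices
`[αⁿ⁺¹(U₊) : αⁿ(U₊)]` is constant. For `U` compact and open and `α` continuous,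
`αⁿ(U₊) ≤ αⁿ⁺¹(U₊)` and these indices are finite. -/
def IsTidyBelow [TopologicalSpace G] (α : G →* G) (U : Subgroup G) : Prop :=
  IsClosed (plusPlus α U) ∧
    ∃ c : ℕ, ∀ n : ℕ, (iterMap α n (plus α U)).relIndex (iterMap α (n + 1) (plus α U)) = c

/-- A subgroup is tidy if it is tidy above and tidy below. -/
def IsTidy [TopologicalSpace G] (α : G →* G) (U : Subgroup G) : Prop :=
  IsTidyAbove α U ∧ IsTidyBelow α U

end TidyEnd

/-! Write d(α, U) for the displacement index. It satisfies d(αⁿ, U) ≤ d(α, U)ⁿ, and for two compact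
open subgroups d(αⁿ, U) and d(αⁿ, V) agree up to factors independent of n. Call U multiplicative if
d(αⁿ, U) = d(α, U)ⁿ for all n. Taking n-th roots, a multiplicative U is minimizing, and once some
multiplicative subgroup exists, every minimizing one is multiplicative.

Minimizing subgroups satisfy TA, by comparison with the subgroups of points staying in U for n
steps. Under TA, multiplicativity is equivalent to TB1 and TB2 (`IsTidyAbove.isTidyBelow`,
`IsTidy.displacementIndex_iterHom`).

It remains to find one multiplicative subgroup. Start from a minimizing U. The homoclinic group ℒ =
U₊₊ ∩ U₋₋ is relatively compact, α(ℒ) = ℒ, and ℒ contains every element of U₊₊ killed by α. The set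
T = {x : ℒx ⊆ Uℒ} is a compact open monoid, hence a group, and contains ℒ. With P = U₊₊ ∩ T one has
P ≤ α(P) and d(αⁿ, T) = [αⁿ(P) : P]; as α is injective on U₊₊ up to ℒ ≤ P, this equals [α(P) : P]ⁿ.
-/

namespace Subgroup

/-! ### Relative indices and compact open subgroups -/

variable {G : Type*} [Group G]

/-- If every element of `K'` is the product of an element of `K` and one of `H`, then
`H` has the same relative index in `K` and `K'`. -/
theorem relIndex_eq_of_forall_exists_mul {H K K' : Subgroup G} (hK : K ≤ K')
    (h : ∀ x ∈ K', ∃ k ∈ K, k⁻¹ * x ∈ H) : H.relIndex K = H.relIndex K' := by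
  refine Nat.card_congr (Equiv.ofBijective (quotientSubgroupOfEmbeddingOfLE H hK)
    ⟨(quotientSubgroupOfEmbeddingOfLE H hK).injective, fun q => ?_⟩)
  induction q using QuotientGroup.induction_on with
  | H x =>
    obtain ⟨k, hk, hkx⟩ := h x x.2
    refine ⟨QuotientGroup.mk ⟨k, hk⟩, ?_⟩
    rw [quotientSubgroupOfEmbeddingOfLE_apply_mk]
    exact QuotientGroup.eq.2 (mem_subgroupOf.2 hkx)

/-- If `H` has the same finite relative index in `K ≤ K'` and in `K'`, then `K' ⊆ K H`. -/
theorem exists_mul_of_relIndex_le {H K K' : Subgroup G} (hK : K ≤ K')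
    (h0 : H.relIndex K' ≠ 0) (h : H.relIndex K' ≤ H.relIndex K) {x : G} (hx : x ∈ K') :
    ∃ k ∈ K, k⁻¹ * x ∈ H := by
  have hfin : Finite (K' ⧸ H.subgroupOf K') := Nat.finite_of_card_ne_zero h0
  have hsurj := ((quotientSubgroupOfEmbeddingOfLE H hK).injective.bijective_of_nat_card_le h).2
  obtain ⟨q, hq⟩ := hsurj (QuotientGroup.mk ⟨x, hx⟩)
  induction q using QuotientGroup.induction_on with
  | H k =>
    rw [quotientSubgroupOfEmbeddingOfLE_apply_mk] at hq
    exact ⟨k, k.2, mem_subgroupOf.1 (QuotientGroup.eq.1 hq)⟩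

/-- Taking images does not increase relative indices. -/
theorem relIndex_map_le {H K : Subgroup G} (f : G →* G) (h0 : H.relIndex K ≠ 0) :
    (H.map f).relIndex (K.map f) ≤ H.relIndex K := by
  rw [← relIndex_comap]
  exact relIndex_le_of_le_left (le_comap_map f H) h0

theorem relIndex_map_ne_zero {H K : Subgroup G} (f : G →* G) (h0 : H.relIndex K ≠ 0) :
    (H.map f).relIndex (K.map f) ≠ 0 := by
  rw [← relIndex_comap]
  exact fun h => h0 (relIndex_eq_zero_of_le_left (le_comap_map f H) h)

/-- An open subgroup has finite relative index in every subgroup of a compact subgroup. -/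
theorem relIndex_ne_zero_of_isOpen_of_isCompact [TopologicalSpace G] [IsTopologicalGroup G]
    {H K : Subgroup G} (hH : IsOpen (H : Set G)) (hK : IsCompact (K : Set G)) :
    H.relIndex K ≠ 0 := by
  have : CompactSpace K := isCompact_iff_compactSpace.1 hK
  have ho : IsOpen (H.subgroupOf K : Set K) := hH.preimage continuous_subtype_val
  have := Subgroup.quotient_finite_of_isOpen _ ho
  exact Nat.pos_iff_ne_zero.1 Nat.card_pos

/-- A subgroup meeting an open subgroup in a closed set is closed. -/
theorem isClosed_of_isClosed_inf [TopologicalSpace G] [IsTopologicalGroup G] {H U : Subgroup G}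
    (hU : IsOpen (U : Set G)) (h : IsClosed ((H ⊓ U : Subgroup G) : Set G)) :
    IsClosed (H : Set G) := by
  refine isClosed_of_closure_subset fun x hx => ?_
  obtain ⟨y, hyx, hyH⟩ := mem_closure_iff.1 hx {y | y⁻¹ * x ∈ U}
    (hU.preimage (by fun_prop)) (by simp [U.one_mem])
  have hcl : y⁻¹ * x ∈ H.topologicalClosure :=
    mul_mem (inv_mem (H.le_topologicalClosure hyH)) hx
  have hmem : y⁻¹ * x ∈ _root_.closure ((U : Set G) ∩ H) := hU.inter_closure ⟨hyx, hcl⟩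
  rw [Set.inter_comm, ← coe_inf, h.closure_eq] at hmem
  simpa using mul_mem hyH hmem.1

/-- A compact submonoid of a Hausdorff topological group is closed under inverses. -/
theorem inv_mem_of_isCompact_submonoid [TopologicalSpace G] [IsTopologicalGroup G] [T2Space G]
    {M : Submonoid G} (hM : IsCompact (M : Set G)) {x : G} (hx : x ∈ M) : x⁻¹ ∈ M := by
  -- The compact semigroup xM contains an idempotent, which in a group can only be 1.
  obtain ⟨e, he, hee⟩ := exists_idempotent_in_compact_subsemigroup
    (fun r : G => continuous_mul_const r) ((x * ·) '' (M : Set G))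
    ⟨x * 1, 1, M.one_mem, rfl⟩ (hM.image (continuous_const_mul x)) (by
      rintro _ ⟨a, ha, rfl⟩ _ ⟨b, hb, rfl⟩
      exact ⟨a * (x * b), M.mul_mem ha (M.mul_mem hx hb), by simp only [mul_assoc]⟩)
  obtain ⟨m, hm, rfl⟩ := he
  have h1 : x * m = 1 := by simpa using hee
  rwa [inv_eq_of_mul_eq_one_right h1]

theorem isClosed_setOf_forall_mul_mem [TopologicalSpace G] [IsTopologicalGroup G] (L : Set G)
    {W : Set G} (hW : IsClosed W) : IsClosed {x : G | ∀ l ∈ L, l * x ∈ W} := by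
  simp only [Set.ofPred_forall]
  exact isClosed_biInter fun l _ => hW.preimage (continuous_const_mul l)

theorem isOpen_setOf_forall_mul_mem [TopologicalSpace G] [IsTopologicalGroup G] {L W : Set G}
    (hL : IsCompact L) (hW : IsOpen W) : IsOpen {x : G | ∀ l ∈ L, l * x ∈ W} :=
  isOpen_iff_mem_nhds.2 fun _ hx => hL.eventually_forall_of_forall_eventually fun l hl =>
    (hW.preimage (f := fun p : G × G => p.2 * p.1) (by fun_prop)).mem_nhds (hx l hl)

/-- A totally disconnected, locally compact group has a compact open subgroup. -/
theorem exists_isCompact_isOpen (G : Type*) [Group G] [TopologicalSpace G] [IsTopologicalGroup G]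
    [LocallyCompactSpace G] [TotallyDisconnectedSpace G] :
    ∃ U : Subgroup G, IsCompact (U : Set G) ∧ IsOpen (U : Set G) := by
  obtain ⟨K, hK, h1K⟩ := exists_compact_mem_nhds (1 : G)
  obtain ⟨W, hW, h1W, hWK⟩ := (loc_compact_Haus_tot_disc_of_zero_dim (H := G)).mem_nhds_iff.1 h1K
  have hWc : IsCompact W := hK.of_isClosed_subset hW.1 hWK
  -- The right stabilizer {x : Wx ⊆ W} of a compact open W containing 1 is a compact open monoid
  -- inside W, hence a group.
  let M : Submonoid G :=
    { carrier := {x | ∀ w ∈ W, w * x ∈ W}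
      one_mem' := fun w hw => by simpa using hw
      mul_mem' := fun {a b} ha hb w hw => by
        rw [← mul_assoc]
        exact hb _ (ha w hw) }
  have hMW : (M : Set G) ⊆ W := fun x hx => by simpa using hx 1 h1W
  have hMc : IsCompact (M : Set G) :=
    hWc.of_isClosed_subset (isClosed_setOf_forall_mul_mem W hW.1) hMW
  have hMo : IsOpen (M : Set G) := isOpen_setOf_forall_mul_mem hWc hW.2
  exact ⟨{ M with inv_mem' := fun hx => inv_mem_of_isCompact_submonoid hMc hx }, hMc, hMo⟩

end Subgroup

/-! ### Displacement indices of the iterates of α -/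

namespace TidyEnd

open Subgroup

variable {G : Type*} [Group G]

/-- The iterate `αⁿ` as a homomorphism. -/
def iterHom (α : G →* G) (n : ℕ) : G →* G where
  toFun := α^[n]
  map_one' := iterate_map_one α n
  map_mul' := iterate_map_mul α n

@[simp]
theorem iterHom_apply (α : G →* G) (n : ℕ) (x : G) : iterHom α n x = α^[n] x := rfl

theorem continuous_iterHom [TopologicalSpace G] {α : G →* G} (hα : Continuous α) (n : ℕ) :
    Continuous (iterHom α n) :=
  hα.iterate n

@[simp]
theorem iterMap_zero (α : G →* G) (H : Subgroup G) : iterMap α 0 H = H := rfl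

theorem iterMap_succ (α : G →* G) (n : ℕ) (H : Subgroup G) :
    iterMap α (n + 1) H = (iterMap α n H).map α :=
  Function.iterate_succ_apply' _ _ _

theorem iterMap_one (α : G →* G) (H : Subgroup G) : iterMap α 1 H = H.map α := rfl

theorem mem_iterMap {α : G →* G} {n : ℕ} {H : Subgroup G} {x : G} :
    x ∈ iterMap α n H ↔ ∃ h ∈ H, α^[n] h = x := by
  induction n generalizing x with
  | zero => simp
  | succ n ih =>
    rw [iterMap_succ, mem_map]
    simp only [ih, Function.iterate_succ_apply']
    constructor
    · rintro ⟨_, ⟨h, hh, rfl⟩, rfl⟩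
      exact ⟨h, hh, rfl⟩
    · rintro ⟨h, hh, rfl⟩
      exact ⟨_, ⟨h, hh, rfl⟩, rfl⟩

theorem iterMap_eq_map (α : G →* G) (n : ℕ) (H : Subgroup G) :
    iterMap α n H = H.map (iterHom α n) := by
  ext x
  simp [mem_iterMap, mem_map]

theorem iterMap_iterHom (α : G →* G) (m n : ℕ) (H : Subgroup G) :
    iterMap (iterHom α m) n H = iterMap α (m * n) H := by
  ext x
  simp only [mem_iterMap, Function.iterate_mul]
  rfl

theorem iterMap_mono (α : G →* G) (n : ℕ) {H K : Subgroup G} (h : H ≤ K) :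
    iterMap α n H ≤ iterMap α n K := by
  rw [iterMap_eq_map, iterMap_eq_map]
  exact map_mono h

theorem iterMap_monotone {α : G →* G} {H : Subgroup G} (h : H ≤ H.map α) :
    Monotone fun n => iterMap α n H :=
  monotone_nat_of_le_succ fun n => iterMap_mono α n h

theorem isCompact_iterMap [TopologicalSpace G] {α : G →* G} (hα : Continuous α) (n : ℕ)
    {H : Subgroup G} (hH : IsCompact (H : Set G)) : IsCompact (iterMap α n H : Set G) := by
  rw [iterMap_eq_map]
  exact hH.image (continuous_iterHom hα n)

theorem displacementIndex_eq (α : G →* G) (U : Subgroup G) :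
    displacementIndex α U = U.relIndex (U.map α) :=
  inf_relIndex_left _ _

theorem displacementIndex_iterHom (α : G →* G) (n : ℕ) (U : Subgroup G) :
    displacementIndex (iterHom α n) U = U.relIndex (iterMap α n U) := by
  rw [displacementIndex_eq, iterMap_eq_map]

section Topological

variable [TopologicalSpace G] [IsTopologicalGroup G]

theorem displacementIndex_ne_zero {α : G →* G} (hα : Continuous α) {U : Subgroup G}
    (hUc : IsCompact (U : Set G)) (hUo : IsOpen (U : Set G)) : displacementIndex α U ≠ 0 := by
  rw [displacementIndex_eq]
  exact relIndex_ne_zero_of_isOpen_of_isCompact hUo (hUc.image hα)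

/-- The displacement index of `αⁿ` is at most the `n`-th power of that of `α`. -/
theorem displacementIndex_iterHom_le_pow {α : G →* G} (hα : Continuous α) {U : Subgroup G}
    (hUc : IsCompact (U : Set G)) (hUo : IsOpen (U : Set G)) (n : ℕ) :
    displacementIndex (iterHom α n) U ≤ displacementIndex α U ^ n := by
  induction n with
  | zero => simp [displacementIndex_iterHom]
  | succ n ih =>
    have hc := isCompact_iterMap hα n hUc
    have hopen : IsOpen (U.comap α : Set G) := hUo.preimage hα
    rw [displacementIndex_iterHom] at ih ⊢
    rw [iterMap_succ, ← relIndex_comap, pow_succ']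
    -- Shrinking α⁻¹(U) to α⁻¹(U) ∩ U lets the index split through U into a factor for α and one for
    -- αⁿ.
    calc (U.comap α).relIndex (iterMap α n U)
        ≤ (U.comap α ⊓ U).relIndex (iterMap α n U) :=
          relIndex_le_of_le_left inf_le_left
            (relIndex_ne_zero_of_isOpen_of_isCompact (hopen.inter hUo) hc)
      _ = (U.comap α).relIndex (U ⊓ iterMap α n U) * U.relIndex (iterMap α n U) :=
          (relIndex_inf_mul_relIndex _ _ _).symm
      _ ≤ displacementIndex α U * displacementIndex α U ^ n := by
          refine Nat.mul_le_mul ?_ ih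
          rw [displacementIndex_eq, ← relIndex_comap]
          exact relIndex_le_of_le_right inf_le_left
            (relIndex_ne_zero_of_isOpen_of_isCompact hopen hUc)

/-- Displacement indices of two compact open subgroups agree up to a factor that does not depend
on the endomorphism. -/
theorem displacementIndex_le_mul {α : G →* G} (hα : Continuous α) {U V : Subgroup G}
    (hUc : IsCompact (U : Set G)) (hUo : IsOpen (U : Set G))
    (hVc : IsCompact (V : Set G)) (hVo : IsOpen (V : Set G)) :
    displacementIndex α U ≤ V.relIndex U * U.relIndex V * displacementIndex α V := by
  have hWo : IsOpen ((U ⊓ V : Subgroup G) : Set G) := hUo.inter hVo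
  rw [displacementIndex_eq, displacementIndex_eq]
  -- Both sides are compared with U ∩ V, at the cost of [U : U ∩ V] and [V : U ∩ V]. An infinite
  -- `relIndex` is 0, so monotonicity of indices needs finiteness each time.
  have h1 : U.relIndex (U.map α) ≤ (U ⊓ V).relIndex ((U ⊓ V).map α) * V.relIndex U := by
    have hne : ((U ⊓ V).map α).relIndex (U.map α) ≠ 0 :=
      relIndex_map_ne_zero α (relIndex_ne_zero_of_isOpen_of_isCompact hWo hUc)
    have hne' : ((U ⊓ V) ⊓ (U ⊓ V).map α).relIndex (U.map α) ≠ 0 := by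
      rw [← relIndex_inf_mul_relIndex]
      refine mul_ne_zero ?_ hne
      rw [inf_eq_left.2 (map_mono inf_le_left)]
      exact fun h => relIndex_ne_zero_of_isOpen_of_isCompact hWo (hUc.image hα)
        (relIndex_eq_zero_of_le_right (map_mono inf_le_left) h)
    calc U.relIndex (U.map α) ≤ ((U ⊓ V) ⊓ (U ⊓ V).map α).relIndex (U.map α) :=
          relIndex_le_of_le_left (inf_le_left.trans inf_le_left) hne'
      _ = (U ⊓ V).relIndex ((U ⊓ V).map α) * ((U ⊓ V).map α).relIndex (U.map α) := by
          rw [← relIndex_inf_mul_relIndex, inf_eq_left.2 (map_mono inf_le_left)]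
      _ ≤ _ := by
          refine Nat.mul_le_mul le_rfl ?_
          rw [← inf_relIndex_left U V]
          exact relIndex_map_le α (relIndex_ne_zero_of_isOpen_of_isCompact hWo hUc)
  have h2 : (U ⊓ V).relIndex ((U ⊓ V).map α) ≤ U.relIndex V * V.relIndex (V.map α) := by
    calc (U ⊓ V).relIndex ((U ⊓ V).map α) ≤ (U ⊓ V).relIndex (V.map α) :=
          relIndex_le_of_le_right (map_mono inf_le_right)
            (relIndex_ne_zero_of_isOpen_of_isCompact hWo (hVc.image hα))
      _ = U.relIndex (V ⊓ V.map α) * V.relIndex (V.map α) :=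
          (relIndex_inf_mul_relIndex _ _ _).symm
      _ ≤ _ := Nat.mul_le_mul (relIndex_le_of_le_right inf_le_left
          (relIndex_ne_zero_of_isOpen_of_isCompact hUo hVc)) le_rfl
  calc _ ≤ _ := h1
    _ ≤ U.relIndex V * V.relIndex (V.map α) * V.relIndex U := Nat.mul_le_mul h2 le_rfl
    _ = _ := by ring

theorem le_of_forall_pow_le_mul_pow {a b C : ℕ} (h : ∀ n, a ^ n ≤ C * b ^ n) : a ≤ b := by
  by_contra! hab
  rcases Nat.eq_zero_or_pos b with rfl | hb
  · have := h 1
    simp only [pow_one, mul_zero] at this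
    lia
  have hb' : (0 : ℝ) < b := by exact_mod_cast hb
  have h1 : (1 : ℝ) < a / b := by
    rw [one_lt_div hb']
    exact_mod_cast hab
  obtain ⟨n, hn⟩ := pow_unbounded_of_one_lt (C : ℝ) h1
  rw [div_pow, lt_div_iff₀ (by positivity)] at hn
  exact absurd (h n) (not_le.2 (by exact_mod_cast hn))

/-- A compact open subgroup whose displacement indices are multiplicative along the iterates of `α`
is minimizing. -/
theorem isMinimizing_of_displacementIndex_iterHom {α : G →* G} (hα : Continuous α)
    {U : Subgroup G} (hUc : IsCompact (U : Set G)) (hUo : IsOpen (U : Set G))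
    (h : ∀ n, displacementIndex (iterHom α n) U = displacementIndex α U ^ n) :
    IsMinimizing α U := by
  intro V hVc hVo
  refine le_of_forall_pow_le_mul_pow (C := V.relIndex U * U.relIndex V) fun n => ?_
  rw [← h n]
  exact (displacementIndex_le_mul (continuous_iterHom hα n) hUc hUo hVc hVo).trans
    (Nat.mul_le_mul le_rfl (displacementIndex_iterHom_le_pow hα hVc hVo n))

/-- If the displacement indices are multiplicative along the iterates of `α` for some compact open
subgroup, then they are so for every minimizing one. -/
theorem IsMinimizing.displacementIndex_iterHom {α : G →* G} (hα : Continuous α)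
    {T V : Subgroup G} (hTc : IsCompact (T : Set G)) (hTo : IsOpen (T : Set G))
    (hT : ∀ n, displacementIndex (iterHom α n) T = displacementIndex α T ^ n)
    (hVc : IsCompact (V : Set G)) (hVo : IsOpen (V : Set G)) (hV : IsMinimizing α V) (n : ℕ) :
    displacementIndex (iterHom α n) V = displacementIndex α V ^ n := by
  have hTV : displacementIndex α T = displacementIndex α V :=
    le_antisymm (isMinimizing_of_displacementIndex_iterHom hα hTc hTo hT V hVc hVo)
      (hV T hTc hTo)
  refine le_antisymm (displacementIndex_iterHom_le_pow hα hVc hVo n) ?_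
  -- With n fixed, the k-th powers of αⁿ are used: the factor comparing T and V is independent of k
  -- and disappears on taking k-th roots.
  refine le_of_forall_pow_le_mul_pow (C := V.relIndex T * T.relIndex V) fun k => ?_
  calc (displacementIndex α V ^ n) ^ k = displacementIndex (iterHom α (n * k)) T := by
        rw [hT, hTV, pow_mul]
    _ ≤ V.relIndex T * T.relIndex V * displacementIndex (iterHom α (n * k)) V :=
        displacementIndex_le_mul (continuous_iterHom hα _) hTc hTo hVc hVo
    _ ≤ _ := by
        refine Nat.mul_le_mul le_rfl ?_
        have := displacementIndex_iterHom_le_pow (continuous_iterHom hα n) hVc hVo k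
        rwa [TidyEnd.displacementIndex_iterHom, iterMap_iterHom,
          ← TidyEnd.displacementIndex_iterHom] at this

end Topological

end TidyEnd

/-! ### Minimizing subgroups are tidy above -/

namespace TidyEnd

open Subgroup

variable {G : Type*} [Group G]

theorem plus_le (α : G →* G) (U : Subgroup G) : plus α U ≤ U := fun _ hx => hx.1

theorem minus_le (α : G →* G) (U : Subgroup G) : minus α U ≤ U := fun _ hx => hx.1

theorem plus_le_map (α : G →* G) (U : Subgroup G) : plus α U ≤ (plus α U).map α := by
  rintro x ⟨_, s, hs, hs0, hs1⟩
  exact ⟨s 1, ⟨hs 1, fun n => s (n + 1), fun n => hs _, rfl, fun n => hs1 _⟩, (hs1 0).trans hs0⟩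

/-- `U₊` contains every subset `S` of `U` with `S ⊆ α(S)`. -/
theorem subset_plus {α : G →* G} {U : Subgroup G} {S : Set G} (hSU : S ⊆ U) (hS : S ⊆ α '' S) :
    S ⊆ plus α U := by
  intro x hx
  have hS' : ∀ y ∈ S, ∃ z ∈ S, α z = y := hS
  choose! f hfS hf using hS'
  have hit : ∀ n, f^[n] x ∈ S := fun n => by
    induction n with
    | zero => exact hx
    | succ n ih =>
      rw [Function.iterate_succ_apply']
      exact hfS _ ih
  refine ⟨hSU hx, fun n => f^[n] x, fun n => hSU (hit n), rfl, fun n => ?_⟩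
  simp only [Function.iterate_succ_apply']
  exact hf _ (hit n)

/-- Maximality of U₊: since U₊ ≤ α(U₊) ∩ U, the set S = α(U₊) ∩ U satisfies S ⊆ α(S). -/
theorem map_plus_inf (α : G →* G) (U : Subgroup G) : (plus α U).map α ⊓ U = plus α U := by
  refine le_antisymm ?_ (le_inf (plus_le_map α U) (plus_le α U))
  refine subset_plus (fun x hx => hx.2) ?_
  rintro x ⟨⟨y, hy, rfl⟩, _⟩
  exact ⟨y, ⟨plus_le_map α U hy, plus_le α U hy⟩, rfl⟩

theorem map_mem_minus {α : G →* G} {U : Subgroup G} {x : G} (hx : x ∈ minus α U) :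
    α x ∈ minus α U :=
  ⟨hx.2 1, fun n => hx.2 (n + 1)⟩

theorem iterate_mem_minus {α : G →* G} {U : Subgroup G} {x : G} (hx : x ∈ minus α U) (n : ℕ) :
    α^[n] x ∈ minus α U := by
  induction n with
  | zero => exact hx
  | succ n ih =>
    rw [Function.iterate_succ_apply']
    exact map_mem_minus ih

/-- The subgroup of elements of `U` whose first `n` images under `α` stay in `U`. -/
def stay (α : G →* G) (U : Subgroup G) : ℕ → Subgroup G
  | 0 => U
  | n + 1 => U ⊓ (stay α U n).comap α

theorem stay_antitone (α : G →* G) (U : Subgroup G) : Antitone (stay α U) := by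
  refine antitone_nat_of_succ_le fun n => ?_
  induction n with
  | zero => exact inf_le_left
  | succ n ih => exact inf_le_inf_left _ (comap_mono ih)

theorem mem_stay {α : G →* G} {U : Subgroup G} {n : ℕ} {x : G} :
    x ∈ stay α U n ↔ ∀ k ≤ n, α^[k] x ∈ U := by
  induction n generalizing x with
  | zero => simp [stay]
  | succ n ih =>
    rw [stay, mem_inf, mem_comap, ih]
    constructor
    · rintro ⟨h0, h⟩ (_ | k) hk
      · exact h0
      · exact h k (by lia)
    · intro h
      exact ⟨h 0 (by lia), fun k hk => h (k + 1) (by lia)⟩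

theorem iterMap_stay_succ_le (α : G →* G) (U : Subgroup G) (n : ℕ) :
    iterMap α (n + 1) (stay α U (n + 1)) ≤ iterMap α n (stay α U n) :=
  iterMap_mono α n (map_le_iff_le_comap.2 inf_le_right)

theorem iterMap_stay_le (α : G →* G) (U : Subgroup G) (n : ℕ) :
    iterMap α n (stay α U n) ≤ U := by
  induction n with
  | zero => exact le_rfl
  | succ n ih => exact (iterMap_stay_succ_le α U n).trans ih

/-- If x stays in U for n steps, then α(x) does so too exactly when αⁿ⁺¹(x) ∈ U. The right-hand side
is the index of U in the image under α of a subgroup of U, so it can be compared with the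
displacement index of U. -/
theorem displacementIndex_stay (α : G →* G) (U : Subgroup G) (n : ℕ) :
    displacementIndex α (stay α U n) = U.relIndex (iterMap α (n + 1) (stay α U n)) := by
  have h : (stay α U n).comap α ⊓ stay α U n = U.comap (iterHom α (n + 1)) ⊓ stay α U n := by
    ext x
    simp only [mem_inf, mem_comap, mem_stay, iterHom_apply]
    constructor
    · rintro ⟨h1, h2⟩
      exact ⟨h1 n le_rfl, h2⟩
    · rintro ⟨h1, h2⟩
      refine ⟨fun k hk => ?_, h2⟩
      rcases hk.eq_or_lt with rfl | hk
      · exact h1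
      · exact h2 (k + 1) hk
  rw [displacementIndex_eq, ← relIndex_comap, ← inf_relIndex_right, h, inf_relIndex_right,
    relIndex_comap, iterMap_eq_map]

section Topological

variable [TopologicalSpace G]

theorem isOpen_stay {α : G →* G} (hα : Continuous α) {U : Subgroup G} (hUo : IsOpen (U : Set G))
    (n : ℕ) : IsOpen (stay α U n : Set G) := by
  induction n with
  | zero => exact hUo
  | succ n ih => exact hUo.inter (ih.preimage hα)

variable [IsTopologicalGroup G]

theorem isCompact_stay {α : G →* G} (hα : Continuous α) {U : Subgroup G}
    (hUc : IsCompact (U : Set G)) (hUo : IsOpen (U : Set G)) (n : ℕ) :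
    IsCompact (stay α U n : Set G) :=
  hUc.of_isClosed_subset (isClosed_of_isOpen _ (isOpen_stay hα hUo n))
    (stay_antitone α U (Nat.zero_le n))

theorem isClosed_minus {α : G →* G} (hα : Continuous α) {U : Subgroup G}
    (hUo : IsOpen (U : Set G)) : IsClosed (minus α U : Set G) := by
  have h : (minus α U : Set G) = ⋂ n : ℕ, α^[n] ⁻¹' (U : Set G) := by
    ext x
    simp only [Set.mem_iInter, Set.mem_preimage, SetLike.mem_coe]
    exact ⟨fun hx => hx.2, fun hx => ⟨hx 0, hx⟩⟩
  rw [h]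
  exact isClosed_iInter fun n => (isClosed_of_isOpen _ hUo).preimage (hα.iterate n)

theorem isCompact_minus {α : G →* G} (hα : Continuous α) {U : Subgroup G}
    (hUc : IsCompact (U : Set G)) (hUo : IsOpen (U : Set G)) : IsCompact (minus α U : Set G) :=
  hUc.of_isClosed_subset (isClosed_minus hα hUo) (minus_le α U)

variable [T2Space G]

/-- The sets on the right decrease. A point of their intersection S has a preimage in each of them,
hence by compactness one in S; so S ⊆ α(S) and `subset_plus` applies. -/
theorem plus_eq_iInter {α : G →* G} (hα : Continuous α) {U : Subgroup G}
    (hUc : IsCompact (U : Set G)) (hUo : IsOpen (U : Set G)) :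
    (plus α U : Set G) = ⋂ n, (iterMap α n (stay α U n) : Set G) := by
  refine Set.Subset.antisymm ?_ ?_
  · rintro x ⟨_, s, hs, hs0, hs1⟩
    have hk : ∀ k n, α^[k] (s (n + k)) = s n := fun k => by
      induction k with
      | zero => exact fun n => rfl
      | succ k ih =>
        intro n
        rw [Function.iterate_succ_apply, ← add_assoc, hs1, ih]
    refine Set.mem_iInter.2 fun n => mem_iterMap.2 ⟨s n, mem_stay.2 fun k hkn => ?_, ?_⟩
    · obtain ⟨m, rfl⟩ := Nat.exists_eq_add_of_le' hkn
      rw [hk]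
      exact hs m
    · have := hk n 0
      rwa [zero_add, hs0] at this
  · refine subset_plus (fun x hx => Set.mem_iInter.1 hx 0) fun x hx => ?_
    have hne : (⋂ n, (iterMap α n (stay α U n) : Set G) ∩ α ⁻¹' {x}).Nonempty := by
      have hcpt : ∀ n, IsCompact ((iterMap α n (stay α U n) : Set G) ∩ α ⁻¹' {x}) := fun n =>
        (isCompact_iterMap hα n (isCompact_stay hα hUc hUo n)).inter_right
          (isClosed_singleton.preimage hα)
      refine IsCompact.nonempty_iInter_of_sequence_nonempty_isCompact_isClosed _
        (fun n => Set.inter_subset_inter_left _ (iterMap_stay_succ_le α U n)) (fun n => ?_)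
        (hcpt 0) (fun n => (hcpt n).isClosed)
      obtain ⟨y, hy, rfl⟩ := mem_iterMap.1 (Set.mem_iInter.1 hx (n + 1))
      rw [Function.iterate_succ_apply']
      exact ⟨_, mem_iterMap.2 ⟨y, stay_antitone α U (Nat.le_succ n) hy, rfl⟩, rfl⟩
    obtain ⟨y, hy⟩ := hne
    rw [Set.mem_iInter] at hy
    exact ⟨y, Set.mem_iInter.2 fun n => (hy n).1, (hy 0).2⟩

theorem isCompact_plus {α : G →* G} (hα : Continuous α) {U : Subgroup G}
    (hUc : IsCompact (U : Set G)) (hUo : IsOpen (U : Set G)) : IsCompact (plus α U : Set G) := by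
  rw [plus_eq_iInter hα hUc hUo]
  exact hUc.of_isClosed_subset
    (isClosed_iInter fun n => (isCompact_iterMap hα n (isCompact_stay hα hUc hUo n)).isClosed)
    (Set.iInter_subset _ 0)

/-- If `U = U₊ (U ∩ α⁻¹(U))`, then `U` is tidy above. -/
theorem isTidyAbove_of_exists_plus_mul_stay_one {α : G →* G} (hα : Continuous α) {U : Subgroup G}
    (hUc : IsCompact (U : Set G)) (hUo : IsOpen (U : Set G))
    (h : ∀ u ∈ U, ∃ p ∈ plus α U, p⁻¹ * u ∈ stay α U 1) : IsTidyAbove α U := by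
  have hn : ∀ n, ∀ u ∈ U, ∃ p ∈ plus α U, p⁻¹ * u ∈ stay α U n := fun n => by
    induction n with
    | zero => exact fun u hu => ⟨1, one_mem _, by simpa [stay] using hu⟩
    | succ n ih =>
      intro u hu
      obtain ⟨p, hp, hpu⟩ := h u hu
      obtain ⟨p', hp', hpu'⟩ := ih _ hpu.2
      -- Writing p' = α(q) with q ∈ U₊ pulls the correction of α(p⁻¹u) back to a correction of p⁻¹u
      -- itself.
      obtain ⟨q, hq, rfl⟩ := plus_le_map α U hp'
      refine ⟨p * q, mul_mem hp hq, ?_, ?_⟩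
      · rw [mul_inv_rev, mul_assoc]
        exact U.mul_mem (U.inv_mem (plus_le α U hq)) hpu.1
      · rw [mul_inv_rev, mul_assoc]
        simpa using hpu'
  refine Set.Subset.antisymm (fun u hu => ?_) ?_
  · have hcpt : ∀ n, IsCompact ((plus α U : Set G) ∩ (fun p => p⁻¹ * u) ⁻¹' stay α U n) :=
      fun n => (isCompact_plus hα hUc hUo).inter_right
        ((isClosed_of_isOpen _ (isOpen_stay hα hUo n)).preimage (by fun_prop))
    obtain ⟨p, hp⟩ := IsCompact.nonempty_iInter_of_sequence_nonempty_isCompact_isClosed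
      (fun n => (plus α U : Set G) ∩ (fun p => p⁻¹ * u) ⁻¹' stay α U n)
      (fun n => Set.inter_subset_inter_right _
        (Set.preimage_mono (stay_antitone α U (Nat.le_succ n))))
      (fun n => (hn n u hu).imp fun p hp => hp) (hcpt 0) (fun n => (hcpt n).isClosed)
    rw [Set.mem_iInter] at hp
    have hm : ∀ n, α^[n] (p⁻¹ * u) ∈ U := fun n => mem_stay.1 (hp n).2 n le_rfl
    exact ⟨p, (hp 0).1, p⁻¹ * u, ⟨hm 0, hm⟩, mul_inv_cancel_left p u⟩
  · rintro _ ⟨p, hp, m, hm, rfl⟩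
    exact mul_mem (plus_le α U hp) (minus_le α U hm)

/-- Let Wₙ be the image under αⁿ of the points staying in U for n steps. Minimality of U against
those points bounds the index of U in α(U) by that in α(Wₙ), so α(U) ⊆ α(Wₙ)U. Hence U = Wₙ(U ∩
α⁻¹(U)), and compactness replaces Wₙ by ⋂ Wₙ = U₊. -/
theorem IsMinimizing.isTidyAbove {α : G →* G} (hα : Continuous α) {U : Subgroup G}
    (hUc : IsCompact (U : Set G)) (hUo : IsOpen (U : Set G)) (hU : IsMinimizing α U) :
    IsTidyAbove α U := by
  refine isTidyAbove_of_exists_plus_mul_stay_one hα hUc hUo fun u hu => ?_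
  have hcpt : ∀ n, IsCompact ((iterMap α n (stay α U n) : Set G) ∩
      (fun p => p⁻¹ * u) ⁻¹' stay α U 1) := fun n =>
    (isCompact_iterMap hα n (isCompact_stay hα hUc hUo n)).inter_right
      ((isClosed_of_isOpen _ (isOpen_stay hα hUo 1)).preimage (by fun_prop))
  have hne : (⋂ n, (iterMap α n (stay α U n) : Set G) ∩
      (fun p => p⁻¹ * u) ⁻¹' stay α U 1).Nonempty := by
    refine IsCompact.nonempty_iInter_of_sequence_nonempty_isCompact_isClosed _
      (fun n => Set.inter_subset_inter_left _ (iterMap_stay_succ_le α U n)) (fun n => ?_)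
      (hcpt 0) (fun n => (hcpt n).isClosed)
    have hle := hU _ (isCompact_stay hα hUc hUo n) (isOpen_stay hα hUo n)
    have h0 := displacementIndex_ne_zero hα hUc hUo
    rw [displacementIndex_stay, displacementIndex_eq] at hle
    rw [displacementIndex_eq] at h0
    rw [iterMap_succ] at hle
    obtain ⟨_, ⟨w, hw, rfl⟩, hwu⟩ := exists_mul_of_relIndex_le
      (map_mono (iterMap_stay_le α U n)) h0 hle (mem_map_of_mem α hu)
    refine ⟨w, hw, U.mul_mem (U.inv_mem (iterMap_stay_le α U n hw)) hu, ?_⟩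
    rw [← map_inv, ← map_mul] at hwu
    exact hwu
  obtain ⟨p, hp⟩ := hne
  rw [Set.mem_iInter] at hp
  refine ⟨p, ?_, (hp 0).2⟩
  rw [← SetLike.mem_coe, plus_eq_iInter hα hUc hUo]
  exact Set.mem_iInter.2 fun n => (hp n).1

end Topological

end TidyEnd

/-! ### For subgroups that are tidy above: tidiness below and multiplicative indices -/

namespace TidyEnd

open Subgroup

variable {G : Type*} [Group G]

theorem mem_plusPlus {α : G →* G} {U : Subgroup G} {x : G} :
    x ∈ plusPlus α U ↔ ∃ n, x ∈ iterMap α n (plus α U) :=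
  Set.mem_iUnion

theorem iterMap_plus_monotone (α : G →* G) (U : Subgroup G) :
    Monotone fun n => iterMap α n (plus α U) :=
  iterMap_monotone (plus_le_map α U)

/-- `U₊₊` as a subgroup. -/
def plusPlusSubgroup (α : G →* G) (U : Subgroup G) : Subgroup G where
  carrier := plusPlus α U
  one_mem' := mem_plusPlus.2 ⟨0, one_mem _⟩
  mul_mem' := by
    intro x y hx hy
    obtain ⟨m, hm⟩ := mem_plusPlus.1 hx
    obtain ⟨n, hn⟩ := mem_plusPlus.1 hy
    exact mem_plusPlus.2 ⟨max m n, mul_mem (iterMap_plus_monotone α U (le_max_left m n) hm)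
      (iterMap_plus_monotone α U (le_max_right m n) hn)⟩
  inv_mem' := by
    intro x hx
    obtain ⟨m, hm⟩ := mem_plusPlus.1 hx
    exact mem_plusPlus.2 ⟨m, inv_mem hm⟩

theorem mem_plusPlusSubgroup {α : G →* G} {U : Subgroup G} {x : G} :
    x ∈ plusPlusSubgroup α U ↔ ∃ n, x ∈ iterMap α n (plus α U) :=
  mem_plusPlus

theorem iterMap_plus_le_plusPlusSubgroup (α : G →* G) (U : Subgroup G) (n : ℕ) :
    iterMap α n (plus α U) ≤ plusPlusSubgroup α U :=
  fun _ hx => mem_plusPlusSubgroup.2 ⟨n, hx⟩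

theorem plus_le_plusPlusSubgroup (α : G →* G) (U : Subgroup G) :
    plus α U ≤ plusPlusSubgroup α U :=
  iterMap_plus_le_plusPlusSubgroup α U 0

theorem map_plusPlusSubgroup (α : G →* G) (U : Subgroup G) :
    (plusPlusSubgroup α U).map α = plusPlusSubgroup α U := by
  refine le_antisymm ?_ fun x hx => ?_
  · rintro _ ⟨x, hx, rfl⟩
    obtain ⟨n, hn⟩ := mem_plusPlusSubgroup.1 hx
    refine mem_plusPlusSubgroup.2 ⟨n + 1, ?_⟩
    rw [iterMap_succ]
    exact mem_map_of_mem α hn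
  · obtain ⟨n, hn⟩ := mem_plusPlusSubgroup.1 hx
    have := iterMap_plus_monotone α U (Nat.le_succ n) hn
    simp only [Nat.succ_eq_add_one, iterMap_succ] at this
    exact map_mono (iterMap_plus_le_plusPlusSubgroup α U n) this

theorem IsTidyAbove.exists_plus_mul_minus {α : G →* G} {U : Subgroup G} (h : IsTidyAbove α U)
    {u : G} (hu : u ∈ U) : ∃ p ∈ plus α U, ∃ m ∈ minus α U, p * m = u := by
  have : u ∈ (plus α U : Set G) * (minus α U : Set G) := h ▸ hu
  exact this

theorem IsTidyAbove.exists_minus_mul_plus {α : G →* G} {U : Subgroup G} (h : IsTidyAbove α U)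
    {u : G} (hu : u ∈ U) : ∃ m ∈ minus α U, ∃ p ∈ plus α U, m * p = u := by
  obtain ⟨p, hp, m, hm, hpm⟩ := h.exists_plus_mul_minus (inv_mem hu)
  exact ⟨m⁻¹, inv_mem hm, p⁻¹, inv_mem hp, by rw [← mul_inv_rev, hpm, inv_inv]⟩

/-- As αⁿ(U₋) ≤ U, the factorization U = U₊U₋ gives αⁿ(U) ⊆ αⁿ(U₊)U. -/
theorem IsTidyAbove.displacementIndex_iterHom {α : G →* G} {U : Subgroup G}
    (h : IsTidyAbove α U) (n : ℕ) :
    displacementIndex (iterHom α n) U = U.relIndex (iterMap α n (plus α U)) := by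
  rw [TidyEnd.displacementIndex_iterHom]
  refine (relIndex_eq_of_forall_exists_mul (iterMap_mono α n (plus_le α U)) fun x hx => ?_).symm
  obtain ⟨u, hu, rfl⟩ := mem_iterMap.1 hx
  obtain ⟨p, hp, m, hm, rfl⟩ := h.exists_plus_mul_minus hu
  refine ⟨α^[n] p, mem_iterMap.2 ⟨p, hp, rfl⟩, ?_⟩
  rw [iterate_map_mul, inv_mul_cancel_left]
  exact hm.2 n

/-- For an increasing sequence of subgroups, relative indices multiply. -/
theorem relIndex_eq_prod {H : ℕ → Subgroup G} (hH : Monotone H) (n : ℕ) :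
    (H 0).relIndex (H n) = ∏ k ∈ Finset.range n, (H k).relIndex (H (k + 1)) := by
  induction n with
  | zero => simp
  | succ n ih =>
    rw [Finset.prod_range_succ, ← ih,
      relIndex_mul_relIndex _ _ _ (hH (Nat.zero_le n)) (hH (Nat.le_succ n))]

theorem relIndex_map_plus (α : G →* G) (U : Subgroup G) :
    (plus α U).relIndex ((plus α U).map α) = U.relIndex ((plus α U).map α) := by
  rw [← inf_relIndex_left ((plus α U).map α) U, map_plus_inf]

theorem IsTidyAbove.displacementIndex_eq {α : G →* G} {U : Subgroup G} (h : IsTidyAbove α U) :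
    displacementIndex α U = (plus α U).relIndex ((plus α U).map α) := by
  have h1 := h.displacementIndex_iterHom 1
  rw [TidyEnd.displacementIndex_iterHom, iterMap_one, iterMap_one,
    ← TidyEnd.displacementIndex_eq] at h1
  rw [h1, relIndex_map_plus]

section Topological

variable [TopologicalSpace G] [IsTopologicalGroup G]

theorem relIndex_iterMap_plus_ne_zero {α : G →* G} (hα : Continuous α)
    {U : Subgroup G} (hUc : IsCompact (U : Set G)) (hUo : IsOpen (U : Set G)) (k : ℕ) :
    (iterMap α k (plus α U)).relIndex (iterMap α (k + 1) (plus α U)) ≠ 0 := by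
  induction k with
  | zero =>
    rw [iterMap_zero, zero_add, iterMap_one]
    rw [relIndex_map_plus]
    exact fun h => relIndex_ne_zero_of_isOpen_of_isCompact hUo (hUc.image hα)
      (relIndex_eq_zero_of_le_right (map_mono (plus_le α U)) h)
  | succ k ih =>
    rw [iterMap_succ α k, iterMap_succ α (k + 1)]
    exact relIndex_map_ne_zero α ih

theorem relIndex_iterMap_plus_le {α : G →* G} (hα : Continuous α)
    {U : Subgroup G} (hUc : IsCompact (U : Set G)) (hUo : IsOpen (U : Set G)) (k : ℕ) :
    (iterMap α k (plus α U)).relIndex (iterMap α (k + 1) (plus α U)) ≤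
      (plus α U).relIndex ((plus α U).map α) := by
  induction k with
  | zero => exact le_rfl
  | succ k ih =>
    rw [iterMap_succ α k, iterMap_succ α (k + 1)]
    exact (relIndex_map_le α (relIndex_iterMap_plus_ne_zero hα hUc hUo k)).trans ih

/-- If `U` is tidy above and its displacement indices are multiplicative along the iterates of `α`,
then it is tidy below. -/
theorem IsTidyAbove.isTidyBelow [T2Space G] {α : G →* G} (hα : Continuous α) {U : Subgroup G}
    (hUc : IsCompact (U : Set G)) (hUo : IsOpen (U : Set G)) (hU : IsTidyAbove α U)
    (h : ∀ n, displacementIndex (iterHom α n) U = displacementIndex α U ^ n) :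
    IsTidyBelow α U := by
  have hmono := iterMap_plus_monotone α U
  have hne : ∀ n, (plus α U).relIndex (iterMap α n (plus α U)) ≠ 0 := fun n => by
    have := relIndex_eq_prod hmono n
    rw [iterMap_zero] at this
    rw [this]
    exact Finset.prod_ne_zero_iff.2 fun k _ => relIndex_iterMap_plus_ne_zero hα hUc hUo k
  have hle : ∀ n, (plus α U).relIndex (iterMap α n (plus α U)) ≤ displacementIndex α U ^ n :=
    fun n => by
      have := relIndex_eq_prod hmono n
      rw [iterMap_zero] at this
      rw [this, hU.displacementIndex_eq]
      simpa using Finset.prod_le_pow_card (Finset.range n) _ _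
        fun k _ => relIndex_iterMap_plus_le hα hUc hUo k
  have hge : ∀ n, displacementIndex α U ^ n = U.relIndex (iterMap α n (plus α U)) := fun n => by
    rw [← h n, hU.displacementIndex_iterHom]
  -- The index of U₊ in αⁿ(U₊) is squeezed between the index of U there and d(α, U)ⁿ, which agree.
  -- Equality forces αⁿ(U₊) ∩ U = U₊, hence U₊₊ ∩ U = U₊, which is compact.
  have hpow : ∀ n, (plus α U).relIndex (iterMap α n (plus α U)) = displacementIndex α U ^ n :=
    fun n => le_antisymm (hle n) ((hge n).trans_le (relIndex_le_of_le_left (plus_le α U) (hne n)))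
  have hinf : ∀ n, iterMap α n (plus α U) ⊓ U ≤ plus α U := fun n => by
    have h1 := relIndex_mul_relIndex (plus α U) (iterMap α n (plus α U) ⊓ U)
      (iterMap α n (plus α U)) (le_inf (hmono (Nat.zero_le n)) (plus_le α U)) inf_le_left
    rw [inf_relIndex_left, ← hge n, hpow n] at h1
    have h0 := hne n
    rw [hpow n] at h0
    exact relIndex_eq_one.1 (mul_eq_right₀ h0 |>.1 h1)
  refine ⟨?_, displacementIndex α U, fun n => ?_⟩
  · have heq : plusPlusSubgroup α U ⊓ U = plus α U := by
      refine le_antisymm (fun x hx => ?_) (le_inf (plus_le_plusPlusSubgroup α U) (plus_le α U))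
      obtain ⟨n, hn⟩ := mem_plusPlusSubgroup.1 hx.1
      exact hinf n ⟨hn, hx.2⟩
    have hcl : IsClosed ((plusPlusSubgroup α U ⊓ U : Subgroup G) : Set G) := by
      rw [heq]
      exact (isCompact_plus hα hUc hUo).isClosed
    exact isClosed_of_isClosed_inf hUo hcl
  · have h1 := relIndex_mul_relIndex (plus α U) _ _ (hmono (Nat.zero_le n)) (hmono (Nat.le_succ n))
    simp only [Nat.succ_eq_add_one, hpow, pow_succ] at h1
    exact Nat.eq_of_mul_eq_mul_left
      (Nat.pos_of_ne_zero (pow_ne_zero n (displacementIndex_ne_zero hα hUc hUo))) h1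

/-- A compact subgroup covered by an increasing sequence of closed subgroups lies in one of
them. -/
theorem exists_le_of_isCompact_of_forall_exists_mem [T2Space G] {H : Subgroup G}
    (hH : IsCompact (H : Set G)) {F : ℕ → Subgroup G} (hF : Monotone F)
    (hcl : ∀ n, IsClosed (F n : Set G)) (h : ∀ x ∈ H, ∃ n, x ∈ F n) : ∃ n, H ≤ F n := by
  have : CompactSpace H := isCompact_iff_compactSpace.1 hH
  have hcov : ⋃ n, ((F n).subgroupOf H : Set H) = Set.univ :=
    Set.eq_univ_of_forall fun x => Set.mem_iUnion.2 (h x x.2)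
  -- By the Baire category theorem some member has interior in H; from there on all are open in H,
  -- and compactness finishes.
  obtain ⟨n, x, hx⟩ := nonempty_interior_of_iUnion_of_closed
    (fun n => (hcl n).preimage continuous_subtype_val) hcov
  have hmono : Monotone fun k => (F k).subgroupOf H := fun _ _ hab => comap_mono (hF hab)
  have hopen : ∀ k, IsOpen ((F (n + k)).subgroupOf H : Set H) := fun k =>
    isOpen_mono (hmono (Nat.le_add_right n k))
      (isOpen_of_mem_nhds _ (mem_interior_iff_mem_nhds.1 hx))
  obtain ⟨k, hk⟩ := isCompact_univ.elim_directed_cover _ hopen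
    (fun x _ => by
      obtain ⟨m, hm⟩ := h x x.2
      exact Set.mem_iUnion.2 ⟨m, hF (Nat.le_add_left m n) hm⟩)
    (Monotone.directed_le fun a b hab => hmono (Nat.add_le_add_left hab n))
  exact ⟨n + k, fun x hx => hk (Set.mem_univ ⟨x, hx⟩)⟩

/-- By TB1, U₊₊ ∩ U₋ is compact, so it lies in a single αⁿ(U₊). It is mapped into itself by α, and
TB2 gives α⁻¹(A) ∩ A = αⁿ(U₊) for A = αⁿ⁺¹(U₊), so n descends to 0. TA then passes from U₋ to U. -/
theorem IsTidy.plusPlusSubgroup_inf [T2Space G] {α : G →* G} (hα : Continuous α) {U : Subgroup G}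
    (hUc : IsCompact (U : Set G)) (hUo : IsOpen (U : Set G)) (hU : IsTidy α U) :
    plusPlusSubgroup α U ⊓ U = plus α U := by
  obtain ⟨hTA, hcl, c, hc⟩ := hU
  have hmono := iterMap_plus_monotone α U
  have hstep : ∀ n, ∀ x ∈ iterMap α (n + 1) (plus α U), α x ∈ iterMap α (n + 1) (plus α U) →
      x ∈ iterMap α n (plus α U) := by
    intro n x hx hαx
    let A := iterMap α (n + 1) (plus α U)
    have hle : iterMap α n (plus α U) ≤ A.comap α ⊓ A := by
      refine le_inf (map_le_iff_le_comap.1 ?_) (hmono (Nat.le_succ n))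
      rw [← iterMap_succ]
    have h1 := relIndex_mul_relIndex _ _ _ hle (inf_le_right : A.comap α ⊓ A ≤ A)
    rw [inf_relIndex_right, relIndex_comap, ← iterMap_succ, hc, hc] at h1
    have hc0 : c ≠ 0 := hc 0 ▸ relIndex_iterMap_plus_ne_zero hα hUc hUo 0
    exact relIndex_eq_one.1 (mul_eq_right₀ hc0 |>.1 h1) ⟨hαx, hx⟩
  have hM : plusPlusSubgroup α U ⊓ minus α U ≤ plus α U := by
    obtain ⟨n, hn⟩ := exists_le_of_isCompact_of_forall_exists_mem
      (H := plusPlusSubgroup α U ⊓ minus α U) ((isCompact_minus hα hUc hUo).inter_left hcl) hmono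
      (fun n => (isCompact_iterMap hα n (isCompact_plus hα hUc hUo)).isClosed)
      (fun x hx => mem_plusPlusSubgroup.1 hx.1)
    induction n with
    | zero => exact hn
    | succ n ih =>
      refine ih fun x hx => hstep n x (hn hx) (hn ⟨?_, map_mem_minus hx.2⟩)
      rw [← map_plusPlusSubgroup]
      exact mem_map_of_mem α hx.1
  refine le_antisymm (fun x hx => ?_) (le_inf (plus_le_plusPlusSubgroup α U) (plus_le α U))
  obtain ⟨p, hp, m, hm, rfl⟩ := hTA.exists_plus_mul_minus hx.2
  refine mul_mem hp (hM ⟨?_, hm⟩)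
  exact (mul_mem_cancel_left (plus_le_plusPlusSubgroup α U hp)).1 hx.1

/-- For a tidy subgroup, the displacement indices are multiplicative along the iterates. -/
theorem IsTidy.displacementIndex_iterHom [T2Space G] {α : G →* G} (hα : Continuous α)
    {U : Subgroup G} (hUc : IsCompact (U : Set G)) (hUo : IsOpen (U : Set G)) (hU : IsTidy α U)
    (n : ℕ) : displacementIndex (iterHom α n) U = displacementIndex α U ^ n := by
  have hmono := iterMap_plus_monotone α U
  obtain ⟨c, hc⟩ := hU.2.2
  have hinf : iterMap α n (plus α U) ⊓ U = plus α U := by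
    refine le_antisymm ?_ (le_inf (hmono (Nat.zero_le n)) (plus_le α U))
    exact (inf_le_inf_right _ (iterMap_plus_le_plusPlusSubgroup α U n)).trans
      (hU.plusPlusSubgroup_inf hα hUc hUo).le
  have hprod := relIndex_eq_prod hmono n
  simp only [hc, Finset.prod_const, Finset.card_range, iterMap_zero] at hprod
  rw [hU.1.displacementIndex_iterHom, hU.1.displacementIndex_eq, ← inf_relIndex_left, hinf, hprod,
    ← hc 0]
  rfl

end Topological

end TidyEnd

/-! ### The homoclinic subgroup and a subgroup with multiplicative indices -/

namespace TidyEnd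

open Subgroup

variable {G : Type*} [Group G]

/-- The subgroup of elements whose forward orbit ends up in `U₋`. -/
def minusMinus (α : G →* G) (U : Subgroup G) : Subgroup G where
  carrier := {x | ∃ n, α^[n] x ∈ minus α U}
  one_mem' := ⟨0, one_mem _⟩
  mul_mem' := by
    rintro x y ⟨m, hm⟩ ⟨n, hn⟩
    refine ⟨m + n, ?_⟩
    rw [iterate_map_mul]
    refine mul_mem ?_ ?_
    · rw [add_comm, Function.iterate_add_apply]
      exact iterate_mem_minus hm n
    · rw [Function.iterate_add_apply]
      exact iterate_mem_minus hn m
  inv_mem' := by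
    rintro x ⟨n, hn⟩
    refine ⟨n, ?_⟩
    rw [iterate_map_inv]
    exact inv_mem hn

theorem minus_le_minusMinus (α : G →* G) (U : Subgroup G) : minus α U ≤ minusMinus α U :=
  fun _ hx => ⟨0, hx⟩

theorem map_mem_minusMinus {α : G →* G} {U : Subgroup G} {x : G} :
    α x ∈ minusMinus α U ↔ x ∈ minusMinus α U := by
  constructor
  · rintro ⟨n, hn⟩
    exact ⟨n + 1, hn⟩
  · rintro ⟨n, hn⟩
    refine ⟨n, ?_⟩
    rw [← Function.iterate_succ_apply, Function.iterate_succ_apply']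
    exact map_mem_minus hn

/-- The subgroup of elements that have a regressive sequence ending up in `U₊` and a forward orbit
ending up in `U₋`. -/
def homoclinic (α : G →* G) (U : Subgroup G) : Subgroup G :=
  plusPlusSubgroup α U ⊓ minusMinus α U

theorem homoclinic_le_plusPlusSubgroup (α : G →* G) (U : Subgroup G) :
    homoclinic α U ≤ plusPlusSubgroup α U :=
  inf_le_left

theorem homoclinic_le_minusMinus (α : G →* G) (U : Subgroup G) :
    homoclinic α U ≤ minusMinus α U :=
  inf_le_right

theorem map_homoclinic (α : G →* G) (U : Subgroup G) :
    (homoclinic α U).map α = homoclinic α U := by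
  refine le_antisymm ?_ ?_
  · rintro _ ⟨x, hx, rfl⟩
    refine ⟨?_, map_mem_minusMinus.2 hx.2⟩
    have := mem_map_of_mem α hx.1
    rwa [map_plusPlusSubgroup] at this
  · intro x h
    obtain ⟨hx, hx'⟩ := mem_inf.1 h
    rw [← map_plusPlusSubgroup] at hx
    obtain ⟨y, hy, rfl⟩ := hx
    exact ⟨y, ⟨hy, map_mem_minusMinus.1 hx'⟩, rfl⟩

/-- Substitute for injectivity: elements of U₊₊ with the same image under α differ by an element of
ℒ. -/
theorem mem_homoclinic_of_map_eq_one {α : G →* G} {U : Subgroup G} {x : G}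
    (hx : x ∈ plusPlusSubgroup α U) (h : α x = 1) : x ∈ homoclinic α U :=
  ⟨hx, map_mem_minusMinus.1 (h ▸ one_mem _)⟩

/-- If `U` is tidy above, then `U₊₊ ∩ Uℒ ⊆ U₊ℒ`, where `ℒ` is the homoclinic subgroup. -/
theorem IsTidyAbove.mem_plus_mul_homoclinic {α : G →* G} {U : Subgroup G} (hU : IsTidyAbove α U)
    {x : G} (hx : x ∈ plusPlusSubgroup α U) (hxU : x ∈ (U : Set G) * (homoclinic α U : Set G)) :
    x ∈ (plus α U : Set G) * homoclinic α U := by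
  obtain ⟨u, hu, l, hl, rfl⟩ := hxU
  obtain ⟨p, hp, m, hm, rfl⟩ := hU.exists_plus_mul_minus hu
  have hpm : p * m ∈ plusPlusSubgroup α U := (mul_mem_cancel_right (homoclinic_le_plusPlusSubgroup α U hl)).1 hx
  have hm' : m ∈ plusPlusSubgroup α U :=
    (mul_mem_cancel_left (plus_le_plusPlusSubgroup α U hp)).1 hpm
  exact ⟨p, hp, m * l, mul_mem ⟨hm', minus_le_minusMinus α U hm⟩ hl, (mul_assoc _ _ _).symm⟩

/-- The submonoid of all `x` with `ℒx ⊆ Uℒ`, where `ℒ` is the homoclinic subgroup. -/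
def tidyingMonoid (α : G →* G) (U : Subgroup G) : Submonoid G where
  carrier := {x | ∀ l ∈ homoclinic α U, l * x ∈ (U : Set G) * homoclinic α U}
  one_mem' := fun l hl => ⟨1, one_mem _, l, hl, by simp⟩
  mul_mem' := by
    intro x y hx hy l hl
    obtain ⟨u, hu, l', hl', h⟩ := hx l hl
    obtain ⟨u', hu', l'', hl'', h'⟩ := hy l' hl'
    refine ⟨u * u', mul_mem hu hu', l'', hl'', ?_⟩
    simp only at h h' ⊢
    rw [← mul_assoc, ← h, mul_assoc u l', ← h', mul_assoc]

theorem homoclinic_le_tidyingMonoid {α : G →* G} {U : Subgroup G} {x : G}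
    (hx : x ∈ homoclinic α U) : x ∈ tidyingMonoid α U :=
  fun l hl => ⟨1, one_mem _, l * x, mul_mem hl hx, one_mul _⟩

theorem exists_mul_of_mem_tidyingMonoid {α : G →* G} {U : Subgroup G} {x : G}
    (hx : x ∈ tidyingMonoid α U) : x ∈ (U : Set G) * homoclinic α U := by
  simpa using hx 1 (one_mem _)

/-- Write lpm = qnl' with q ∈ U₊, n ∈ U₋, l' ∈ ℒ. Then q⁻¹lp = nl'm⁻¹ lies in U₊₊ by its left side
and in U₋₋ by its right side, hence in ℒ. -/
theorem IsTidyAbove.plus_mem_tidyingMonoid {α : G →* G} {U : Subgroup G} (hU : IsTidyAbove α U)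
    {p m : G} (hp : p ∈ plus α U) (hm : m ∈ minus α U) (h : p * m ∈ tidyingMonoid α U) :
    p ∈ tidyingMonoid α U := by
  intro l hl
  obtain ⟨v, hv, l', hl', h'⟩ := h l hl
  obtain ⟨q, hq, n, hn, rfl⟩ := hU.exists_plus_mul_minus hv
  simp only at h'
  have heq : q⁻¹ * (l * p) = n * l' * m⁻¹ := by
    rw [eq_mul_inv_iff_mul_eq, mul_assoc, mul_assoc, inv_mul_eq_iff_eq_mul, ← h', mul_assoc]
  refine ⟨q, plus_le α U hq, q⁻¹ * (l * p), mem_inf.2 ⟨?_, ?_⟩, mul_inv_cancel_left _ _⟩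
  · exact mul_mem (inv_mem (plus_le_plusPlusSubgroup α U hq))
      (mul_mem (homoclinic_le_plusPlusSubgroup α U hl) (plus_le_plusPlusSubgroup α U hp))
  · rw [heq]
    exact mul_mem (mul_mem (minus_le_minusMinus α U hn) (homoclinic_le_minusMinus α U hl'))
      (inv_mem (minus_le_minusMinus α U hm))

/-- Write lm = nql' with n ∈ U₋, q ∈ U₊, l' ∈ ℒ. Then ql' = n⁻¹lm lies in ℒ, and α preserves both U₋
and ℒ. -/
theorem IsTidyAbove.map_mem_tidyingMonoid {α : G →* G} {U : Subgroup G} (hU : IsTidyAbove α U)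
    {m : G} (hm : m ∈ minus α U) (h : m ∈ tidyingMonoid α U) : α m ∈ tidyingMonoid α U := by
  intro l hl
  rw [← map_homoclinic] at hl
  obtain ⟨l, hl, rfl⟩ := hl
  obtain ⟨v, hv, l', hl', h'⟩ := h l hl
  obtain ⟨n, hn, q, hq, rfl⟩ := hU.exists_minus_mul_plus hv
  simp only [mul_assoc] at h'
  have hmem : q * l' ∈ homoclinic α U := by
    refine mem_inf.2 ⟨mul_mem (plus_le_plusPlusSubgroup α U hq) (homoclinic_le_plusPlusSubgroup α U hl'), ?_⟩
    rw [← eq_inv_mul_iff_mul_eq] at h'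
    rw [h']
    exact mul_mem (inv_mem (minus_le_minusMinus α U hn))
      (mul_mem (homoclinic_le_minusMinus α U hl) (minus_le_minusMinus α U hm))
  refine ⟨α n, minus_le α U (map_mem_minus hn), α (q * l'), ?_, ?_⟩
  · rw [← map_homoclinic]
    exact mem_map_of_mem α hmem
  · simp only [← map_mul, h']

/-- Here α(ly) lies in U₊ℒ, which is contained in α(U₊)α(ℒ); lifting gives qk with the same image as
ly, and the two differ by an element of ℒ. -/
theorem IsTidyAbove.mem_tidyingMonoid_of_map_mem {α : G →* G} {U : Subgroup G}
    (hU : IsTidyAbove α U) {y : G} (hy : y ∈ plusPlusSubgroup α U)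
    (h : α y ∈ tidyingMonoid α U) : y ∈ tidyingMonoid α U := by
  intro l hl
  have hly : l * y ∈ plusPlusSubgroup α U := mul_mem (homoclinic_le_plusPlusSubgroup α U hl) hy
  have hαl : α l ∈ homoclinic α U := by
    rw [← map_homoclinic]
    exact mem_map_of_mem α hl
  have hαly : α (l * y) ∈ plusPlusSubgroup α U := by
    rw [← map_plusPlusSubgroup]
    exact mem_map_of_mem α hly
  obtain ⟨p, hp, l', hl', h'⟩ := hU.mem_plus_mul_homoclinic hαly
    (by rw [map_mul]; exact h _ hαl)
  obtain ⟨q, hq, rfl⟩ := plus_le_map α U hp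
  rw [SetLike.mem_coe, ← map_homoclinic] at hl'
  obtain ⟨k, hk, rfl⟩ := hl'
  have hqU := plus_le_plusPlusSubgroup α U hq
  have hmem : (q * k)⁻¹ * (l * y) ∈ homoclinic α U := by
    refine mem_homoclinic_of_map_eq_one (mul_mem (inv_mem (mul_mem hqU (homoclinic_le_plusPlusSubgroup α U hk))) hly) ?_
    rw [map_mul, map_inv, ← h', map_mul, inv_mul_cancel]
  refine ⟨q, plus_le α U hq, k * ((q * k)⁻¹ * (l * y)), mul_mem hk hmem, ?_⟩
  simp only
  group

/-- If `U` is tidy above and its tidying monoid is a subgroup `T`, then the displacement indices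
of `T` are multiplicative along the iterates of `α`. -/
theorem IsTidyAbove.displacementIndex_tidyingMonoid {α : G →* G} {U : Subgroup G}
    (hU : IsTidyAbove α U) {T : Subgroup G} (hT : T.toSubmonoid = tidyingMonoid α U) (n : ℕ) :
    displacementIndex (iterHom α n) T = displacementIndex α T ^ n := by
  have hmem : ∀ {x}, x ∈ T ↔ x ∈ tidyingMonoid α U := fun {x} => by rw [← hT]; rfl
  -- P plays for T the role that U₊ plays for U.
  let P := plusPlusSubgroup α U ⊓ T
  have hLP : homoclinic α U ≤ P :=
    le_inf inf_le_left fun x hx => hmem.2 (homoclinic_le_tidyingMonoid hx)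
  have hPP : P ≤ P.map α := by
    intro x h
    obtain ⟨hx, hxT⟩ := mem_inf.1 h
    rw [← map_plusPlusSubgroup] at hx
    obtain ⟨y, hy, rfl⟩ := hx
    exact ⟨y, ⟨hy, hmem.2 (hU.mem_tidyingMonoid_of_map_mem hy (hmem.1 hxT))⟩, rfl⟩
  have hmono := iterMap_monotone hPP
  have hpp : ∀ n, iterMap α n P ≤ plusPlusSubgroup α U := fun n => by
    induction n with
    | zero => exact inf_le_left
    | succ n ih =>
      rw [iterMap_succ, ← map_plusPlusSubgroup]
      exact map_mono ih
  have hLn : ∀ n, homoclinic α U ≤ iterMap α n P := fun n => hLP.trans (hmono (Nat.zero_le n))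
  have hindex : ∀ n, displacementIndex (iterHom α n) T = P.relIndex (iterMap α n P) := fun n => by
    have hinf : iterMap α n P ⊓ T = P :=
      le_antisymm (inf_le_inf_right _ (hpp n)) (le_inf (hmono (Nat.zero_le n)) inf_le_right)
    rw [TidyEnd.displacementIndex_iterHom]
    have h1 := inf_relIndex_left (iterMap α n P) T
    rw [hinf] at h1
    rw [h1]
    refine (relIndex_eq_of_forall_exists_mul (iterMap_mono α n inf_le_right) fun x hx => ?_).symm
    obtain ⟨t, ht, rfl⟩ := mem_iterMap.1 hx
    obtain ⟨u, hu, l, hl, rfl⟩ := exists_mul_of_mem_tidyingMonoid (hmem.1 ht)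
    have huT : u ∈ T := (mul_mem_cancel_right (mem_inf.1 (hLP hl)).2).1 ht
    obtain ⟨p, hp, m, hm, rfl⟩ := hU.exists_plus_mul_minus hu
    have hpT : p ∈ T := hmem.2 (hU.plus_mem_tidyingMonoid hp hm (hmem.1 huT))
    have hmT : m ∈ T := (mul_mem_cancel_left hpT).1 huT
    have hmn : ∀ k, α^[k] m ∈ T := fun k => by
      induction k with
      | zero => exact hmT
      | succ k ih =>
        rw [Function.iterate_succ_apply']
        exact hmem.2 (hU.map_mem_tidyingMonoid (iterate_mem_minus hm k) (hmem.1 ih))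
    have hln : ∀ k, α^[k] l ∈ homoclinic α U := fun k => by
      induction k with
      | zero => exact hl
      | succ k ih =>
        rw [Function.iterate_succ_apply', ← map_homoclinic]
        exact mem_map_of_mem α ih
    refine ⟨α^[n] p, mem_iterMap.2 ⟨p, ⟨plus_le_plusPlusSubgroup α U hp, hpT⟩, rfl⟩, ?_⟩
    rw [iterate_map_mul, iterate_map_mul, mul_assoc, inv_mul_cancel_left]
    exact mul_mem (hmn n) (mem_inf.1 (hLP (hln n))).2
  have hconst : ∀ n, (iterMap α n P).relIndex (iterMap α (n + 1) P) = P.relIndex (P.map α) := by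
    intro n
    induction n with
    | zero => rfl
    | succ n ih =>
      rw [iterMap_succ α (n + 1), ← relIndex_comap, ← ih, ← inf_relIndex_right]
      congr 1
      -- Consecutive indices agree because α⁻¹(αⁿ⁺¹(P)) ∩ αⁿ⁺¹(P) = αⁿ(P): the ambiguity in
      -- preimages within U₊₊ lies in ℒ ≤ αⁿ(P).
      refine le_antisymm ?_ (le_inf ?_ (hmono (Nat.le_succ n)))
      · intro x h
        obtain ⟨hαx, hx⟩ := mem_inf.1 h
        rw [mem_comap, iterMap_succ] at hαx
        obtain ⟨z, hz, hzx⟩ := hαx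
        have hzx' : z⁻¹ * x ∈ homoclinic α U :=
          mem_homoclinic_of_map_eq_one (mul_mem (inv_mem (hpp n hz)) (hpp (n + 1) hx))
            (by rw [map_mul, map_inv, hzx, inv_mul_cancel])
        simpa using mul_mem hz (hLn n hzx')
      · rw [← map_le_iff_le_comap, ← iterMap_succ]
  have h1 : displacementIndex α T = P.relIndex (P.map α) := hindex 1
  have hprod := relIndex_eq_prod hmono n
  simp only [hconst, Finset.prod_const, Finset.card_range, iterMap_zero] at hprod
  rw [hindex, h1, hprod]

section Topological

variable [TopologicalSpace G] [IsTopologicalGroup G] [T2Space G]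

/-- The homoclinic subgroup is relatively compact. -/
theorem isCompact_closure_homoclinic {α : G →* G} (hα : Continuous α) {U : Subgroup G}
    (hUc : IsCompact (U : Set G)) (hUo : IsOpen (U : Set G)) :
    IsCompact (_root_.closure (homoclinic α U : Set G)) := by
  -- ℒ is the increasing union of the αⁿ(Q), and α(Q) ∩ U ≤ Q, so finitely many cosets of Q cover
  -- α(Q).
  let Q := plus α U ⊓ minusMinus α U
  have hQ : Q ≤ Q.map α := by
    rintro x ⟨hx, hx'⟩
    obtain ⟨y, hy, rfl⟩ := plus_le_map α U hx
    exact ⟨y, ⟨hy, map_mem_minusMinus.1 hx'⟩, rfl⟩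
  have hmono := iterMap_monotone hQ
  have hex : ∀ x ∈ homoclinic α U, ∃ n, x ∈ iterMap α n Q := by
    rintro x ⟨hx, hx'⟩
    obtain ⟨n, hn⟩ := mem_plusPlusSubgroup.1 hx
    obtain ⟨y, hy, rfl⟩ := mem_iterMap.1 hn
    refine ⟨n, mem_iterMap.2 ⟨y, ⟨hy, ?_⟩, rfl⟩⟩
    obtain ⟨k, hk⟩ := hx'
    exact ⟨k + n, by rwa [Function.iterate_add_apply]⟩
  have hfin : U.relIndex (Q.map α) ≠ 0 := fun h =>
    relIndex_ne_zero_of_isOpen_of_isCompact hUo (hUc.image hα)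
      (relIndex_eq_zero_of_le_right (map_mono (inf_le_left.trans (plus_le α U))) h)
  have hFin : Finite (Q.map α ⧸ U.subgroupOf (Q.map α)) := Nat.finite_of_card_ne_zero hfin
  have hmm : ∀ q : Q.map α ⧸ U.subgroupOf (Q.map α), ∃ n, α^[n] (q.out : G) ∈ minus α U :=
    fun q => by
      obtain ⟨y, hy, hyq⟩ := q.out.2
      rw [← hyq]
      exact map_mem_minusMinus.2 hy.2
  choose f hf using hmm
  -- By time N all coset representatives have entered U₋. So αⁿ⁺¹(Q) ⊆ U₋αⁿ(Q) for n ≥ N, and ℒ lies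
  -- in the compact set U₋αᴺ(U₊).
  obtain ⟨N, hN⟩ := (Set.finite_range f).bddAbove
  have hstep : ∀ n, N ≤ n → ∀ x ∈ iterMap α (n + 1) Q, ∃ m ∈ minus α U,
      m⁻¹ * x ∈ iterMap α n Q := by
    intro n hn x hx
    obtain ⟨y, hy, rfl⟩ := mem_iterMap.1 hx
    let z : Q.map α := ⟨α y, mem_map_of_mem α hy⟩
    let q : Q.map α ⧸ U.subgroupOf (Q.map α) := QuotientGroup.mk z
    have hzU : (q.out : G)⁻¹ * α y ∈ U := by
      have : QuotientGroup.mk (s := U.subgroupOf (Q.map α)) q.out = QuotientGroup.mk z :=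
        QuotientGroup.out_eq' q
      exact mem_subgroupOf.1 (QuotientGroup.eq.1 this)
    have hzQ : (q.out : G)⁻¹ * α y ∈ Q := by
      have hmap : (q.out : G)⁻¹ * α y ∈ Q.map α := mul_mem (inv_mem q.out.2) z.2
      obtain ⟨w, hw, hwe⟩ := hmap
      rw [← hwe] at hzU ⊢
      refine ⟨?_, map_mem_minusMinus.2 hw.2⟩
      rw [← map_plus_inf]
      exact ⟨mem_map_of_mem α hw.1, hzU⟩
    have hfn : f q ≤ n := (hN (Set.mem_range_self q)).trans hn
    obtain ⟨k, rfl⟩ := Nat.exists_eq_add_of_le' hfn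
    refine ⟨α^[k + f q] (q.out : G), ?_, mem_iterMap.2 ⟨_, hzQ, ?_⟩⟩
    · rw [Function.iterate_add_apply]
      exact iterate_mem_minus (hf q) k
    · rw [iterate_map_mul, iterate_map_inv, Function.iterate_succ_apply]
  have hall : ∀ k, ∀ x ∈ iterMap α (N + k) Q, ∃ m ∈ minus α U, m⁻¹ * x ∈ iterMap α N Q := by
    intro k
    induction k with
    | zero => exact fun x hx => ⟨1, one_mem _, by simpa using hx⟩
    | succ k ih =>
      intro x hx
      obtain ⟨m, hm, hmx⟩ := hstep (N + k) (Nat.le_add_right N k) x hx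
      obtain ⟨m', hm', hmx'⟩ := ih _ hmx
      exact ⟨m * m', mul_mem hm hm', by rwa [mul_inv_rev, mul_assoc]⟩
  have hK : IsCompact ((minus α U : Set G) * (iterMap α N (plus α U) : Set G)) :=
    (isCompact_minus hα hUc hUo).mul (isCompact_iterMap hα N (isCompact_plus hα hUc hUo))
  refine hK.of_isClosed_subset isClosed_closure (closure_minimal (fun x hx => ?_) hK.isClosed)
  obtain ⟨n, hn⟩ := hex x hx
  obtain ⟨m, hm, hmx⟩ := hall n x (hmono (Nat.le_add_left n N) hn)
  exact ⟨m, hm, m⁻¹ * x, iterMap_mono α N inf_le_left hmx, mul_inv_cancel_left m x⟩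

theorem isCompact_mul_homoclinic {α : G →* G} (hα : Continuous α) {U : Subgroup G}
    (hUc : IsCompact (U : Set G)) (hUo : IsOpen (U : Set G)) :
    IsCompact ((U : Set G) * (homoclinic α U : Set G)) := by
  rw [← hUo.mul_closure]
  exact hUc.mul (isCompact_closure_homoclinic hα hUc hUo)

/-- Uℒ is closed, so the condition extends to the closure of ℒ, whose compactness makes the monoid
open. -/
theorem coe_tidyingMonoid {α : G →* G} (hα : Continuous α) {U : Subgroup G}
    (hUc : IsCompact (U : Set G)) (hUo : IsOpen (U : Set G)) :
    (tidyingMonoid α U : Set G) = {x | ∀ l ∈ _root_.closure (homoclinic α U : Set G),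
      l * x ∈ (U : Set G) * homoclinic α U} := by
  have hcl := (isCompact_mul_homoclinic hα hUc hUo).isClosed
  refine Set.Subset.antisymm (fun x hx l hl => ?_) fun x hx l hl => hx l (subset_closure hl)
  exact closure_minimal (s := (homoclinic α U : Set G)) hx
    (hcl.preimage (continuous_mul_const x)) hl

theorem isCompact_tidyingMonoid {α : G →* G} (hα : Continuous α) {U : Subgroup G}
    (hUc : IsCompact (U : Set G)) (hUo : IsOpen (U : Set G)) :
    IsCompact (tidyingMonoid α U : Set G) := by
  have hc := isCompact_mul_homoclinic hα hUc hUo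
  exact hc.of_isClosed_subset (isClosed_setOf_forall_mul_mem _ hc.isClosed)
    fun x hx => exists_mul_of_mem_tidyingMonoid hx

theorem isOpen_tidyingMonoid {α : G →* G} (hα : Continuous α) {U : Subgroup G}
    (hUc : IsCompact (U : Set G)) (hUo : IsOpen (U : Set G)) :
    IsOpen (tidyingMonoid α U : Set G) := by
  rw [coe_tidyingMonoid hα hUc hUo]
  exact isOpen_setOf_forall_mul_mem (isCompact_closure_homoclinic hα hUc hUo) hUo.mul_right

/-- There is a compact open subgroup whose displacement indices are multiplicative along the
iterates of `α`. -/
theorem exists_displacementIndex_iterHom_eq_pow [LocallyCompactSpace G]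
    [TotallyDisconnectedSpace G] {α : G →* G} (hα : Continuous α) :
    ∃ T : Subgroup G, IsCompact (T : Set G) ∧ IsOpen (T : Set G) ∧
      ∀ n, displacementIndex (iterHom α n) T = displacementIndex α T ^ n := by
  -- Minimality of U serves only to make it tidy above.
  obtain ⟨U, ⟨hUc, hUo⟩, hmin⟩ := exists_minimalFor_of_wellFoundedLT
    (fun U : Subgroup G => IsCompact (U : Set G) ∧ IsOpen (U : Set G)) (displacementIndex α)
    (Subgroup.exists_isCompact_isOpen G)
  have hU : IsMinimizing α U := fun V hVc hVo =>
    (le_total _ _).elim id fun h => hmin ⟨hVc, hVo⟩ h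
  have hMc := isCompact_tidyingMonoid hα hUc hUo
  exact ⟨{ tidyingMonoid α U with inv_mem' := fun hx => inv_mem_of_isCompact_submonoid hMc hx },
    hMc, isOpen_tidyingMonoid hα hUc hUo,
    (hU.isTidyAbove hα hUc hUo).displacementIndex_tidyingMonoid rfl⟩

theorem IsMinimizing.isTidy [LocallyCompactSpace G] [TotallyDisconnectedSpace G] {α : G →* G}
    (hα : Continuous α) {U : Subgroup G} (hUc : IsCompact (U : Set G))
    (hUo : IsOpen (U : Set G)) (hU : IsMinimizing α U) : IsTidy α U := by
  obtain ⟨T, hTc, hTo, hT⟩ := exists_displacementIndex_iterHom_eq_pow hα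
  have hTA := hU.isTidyAbove hα hUc hUo
  exact ⟨hTA, hTA.isTidyBelow hα hUc hUo
    (hU.displacementIndex_iterHom hα hTc hTo hT hUc hUo)⟩

end Topological

end TidyEnd

theorem mainTheorem1 {G : Type*} [Group G] [TopologicalSpace G] [IsTopologicalGroup G]
    [LocallyCompactSpace G] [TotallyDisconnectedSpace G] (α : G →* G) (hα : Continuous α) :
    (∀ U : Subgroup G, IsCompact (U : Set G) → IsOpen (U : Set G) →
      (TidyEnd.IsMinimizing α U ↔ TidyEnd.IsTidy α U)) ∧
    ∃ U : Subgroup G, IsCompact (U : Set G) ∧ IsOpen (U : Set G) ∧ TidyEnd.IsTidy α U := by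
  refine ⟨fun U hUc hUo => ⟨fun h => h.isTidy hα hUc hUo, fun h =>
    TidyEnd.isMinimizing_of_displacementIndex_iterHom hα hUc hUo
      (h.displacementIndex_iterHom hα hUc hUo)⟩, ?_⟩
  obtain ⟨T, hTc, hTo, hT⟩ := TidyEnd.exists_displacementIndex_iterHom_eq_pow hα
  exact ⟨T, hTc, hTo,
    (TidyEnd.isMinimizing_of_displacementIndex_iterHom hα hTc hTo hT).isTidy hα hTc hTo⟩
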